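/- **Theorem (Convergence of the SDC method).** *Problem.* Let $K\ge 1$, $p_1,\dots,p_K>0$, $\sum_i p_i=1$. Let $c:\mathbb R^{m_1}\to\mathbb R$ and $q_i:\mathbb R^{m_2}\to\mathbb R$ be convex and twice continuously differentiable, and let $P_1:\mathbb R^{k_1}\to\mathbb R$, $P_{\xi_i}:\mathbb R^{k_{2,i}}\to\mathbb R$ be lower semicontinuous and bounded from below ($i\in[K]$). Let $U_1,u_1,U_{\xi_i},u_{\xi_i},A,a,B,b,A_{1,i},A_{2,i},d_i,W_i,T_i,h_i$ be real matrices and vectors of matching sizes, and let $C_1\subseteq\mathbb R^{s_1}$, $C_{2,i}\subseteq\mathbb R^{s_2}$ be closed convex cones (for example second-order cones, nonnegative orthants, positive semidefinite cones, or products of these). For ${\bf x_y}=(x;y_1;\dots;y_K)\in\mathbb R^{m_1}\times(\mathbb R^{m_2})^K$ put $$\hat f({\bf x_y})=c(x)+\sum_i p_iq_i(y_i),\quad \mathcal U({\bf x_y})=(U_1x+u_1;\,U_{\xi_i}y_i+u_{\xi_i},\,i\in[K]),\quad P(v)=P_1(v_1)+\sum_i p_iP_{\xi_i}(v_{2,i}),$$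 $$G({\bf x_y})=\big(Ax-a;\ Bx-b;\ (A_{1,i}y_i+A_{2,i}x-d_i)_{i};\ (W_iy_i+T_ix-h_i)_{i}\big),\quad \mathcal K=\{0\}\times(-C_1)\times\{0\}^K\times\prod_i(-C_{2,i}),$$ $\Phi=\{{\bf x_y}: G({\bf x_y})\in\mathcal K\}$, $\mathcal K^\circ=\{M:\langle M,w\rangle\le0\ \forall w\in\mathcal K\}$ and $D=\mathbb R^{m_1}\times(\mathbb R^{m_2})^K\times\mathcal K^\circ$. All norms are Euclidean, $\mathbf{Proj}_D$ is the Euclidean projection, and $\nabla L$ denotes the transposed Jacobian of $L$. The problem is $$\min\ \hat f({\bf x_y})+P(\mathcal U({\bf x_y}))\quad\text{s.t. } G({\bf x_y})\in\mathcal K.\tag{1}$$ *Method.* Fix $\eta_1,\eta_2,\eta_3,\tau_1,\tau_2>0$, positive numbers $\rho_t\to0$ and ${\bf z}^0=({\bf x}^0_{\bf y};M^0)\in D$. For $\rho>0$ let $\operatorname{prox}_{\rho f}(w)=\arg\min_{w'}\{\frac1{2\rho}\|w'-w\|^2+f(w')\}$ and $D_{\rho,f}(w)=\sup_{w'}\{\frac1\rho\langle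 w,w'\rangle-\frac1{2\rho}\|w'\|^2-f(w')\}$. In outer iteration $t=0,1,2,\dots$ start from ${\bf z}^{t,0}={\bf z}^0$ (or, as a warm start, from ${\bf z}^{t,0}={\bf z}^t$) and, for $l=0,1,\dots$: 1. choose $\zeta_1\in\operatorname{prox}_{\rho_tP_1}(U_1x^{t,l}+u_1)$ and $\zeta_{\xi_i}\in\operatorname{prox}_{\rho_tP_{\xi_i}}(U_{\xi_i}y_i^{t,l}+u_{\xi_i})$, $i\in[K]$; 2. compute, by progressive hedging or any other procedure, a point ${\bf z}^{t,l+1}=({\bf x}^{t,l+1}_{\bf y};M^{t,l+1})$ with $$\big\|{\bf z}^{t,l+1}-\mathbf{Proj}_D({\bf z}^{t,l+1}-H^L({\bf z}^{t,l+1}))\big\|\le\eta_1\rho_t,\qquad F^L({\bf x}^{t,l+1}_{\bf y})\le F^L({\bf x}^{t,l}_{\bf y})+\frac{\eta_2}{(l+1)^2};$$ 3. if $\tau_1\|x^{t,l+1}-x^{t,l}\|+\tau_2\sum_ip_i\|y_i^{t,l+1}-y_i^{t,l}\|\le\eta_3\rho_t^2$, stop the inner loop, set $l_t=l+1$ and ${\bf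 z}^{t+1}={\bf z}^{t,l_t}$; otherwise continue with $l+1$. Here (for the current $t,l,\zeta$) $$\begin{aligned}F^L({\bf x_y})=\hat f({\bf x_y})&+\tfrac1{2\rho_t}\|U_1x+u_1\|^2-D_{\rho_t,P_1}(U_1x^{t,l}+u_1)-\langle\tfrac1{\rho_t}U_1^T\zeta_1,x-x^{t,l}\rangle+\tfrac{\tau_1}2\|x-x^{t,l}\|^2\\&+\sum_ip_i\Big[\tfrac1{2\rho_t}\|U_{\xi_i}y_i+u_{\xi_i}\|^2-D_{\rho_t,P_{\xi_i}}(U_{\xi_i}y_i^{t,l}+u_{\xi_i})-\langle\tfrac1{\rho_t}U_{\xi_i}^T\zeta_{\xi_i},y_i-y_i^{t,l}\rangle+\tfrac{\tau_2}2\|y_i-y_i^{t,l}\|^2\Big]\end{aligned}$$ and $H^L({\bf x_y};M)=\big(\nabla F^L({\bf x_y})+\nabla G({\bf x_y})M;\ -G({\bf x_y})\big)$, where $$\nabla F^L({\bf x_y})=\nabla\hat f({\bf x_y})+\nabla\mathcal U({\bf x_y})\begin{pmatrix}\frac1{\rho_t}(U_1x+u_1-\zeta_1)\\ \frac{p_i}{\rho_t}(U_{\xi_i}y_i+u_{\xi_i}-\zeta_{\xi_i}),\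 i\in[K]\end{pmatrix}+\begin{pmatrix}\tau_1(x-x^{t,l})\\ p_i\tau_2(y_i-y_i^{t,l}),\ i\in[K]\end{pmatrix}.$$ *Claim.* Suppose that every inner loop stops after finitely many steps, so that the method generates an infinite sequence $\{{\bf z}^{t,l_t}\}_{t\ge0}$, and let ${\bf x}^*_{\bf y}$ be any accumulation point of $\{{\bf x}^{t,l_t}_{\bf y}\}_{t\ge0}$. With $\partial$, $\partial^\infty$ the limiting and horizon subdifferentials and $N$ the limiting normal cone, assume - (A5) there is $(\mathring x,\mathring y_1,\dots,\mathring y_K)$ with $A\mathring x=a$, $A_{1,i}\mathring y_i+A_{2,i}\mathring x=d_i$, $B\mathring x-b\in\operatorname{int}(-C_1)$, $W_i\mathring y_i+T_i\mathring x-h_i\in\operatorname{int}(-C_{2,i})$ for all $i\in[K]$; - (A7) $\lambda\in\partial^\infty P(\mathcal U({\bf x}^*_{\bf y}))$ and $\nabla\mathcal U({\bf x}^*_{\bf y})\lambda=0$ imply $\lambda=0$; - (A10) $P_1$ and $P_{\xi_i}$, $i\in[K]$, are continuous; - (A11) $-\nabla\mathcal U({\bf x}^*_{\bf y})\,\partial^\infty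 P(\mathcal U({\bf x}^*_{\bf y}))\cap N_\Phi({\bf x}^*_{\bf y})\subseteq\{0\}$. Then ${\bf x}^*_{\bf y}$ is a KKT point of (1): ${\bf x}^*_{\bf y}\in\Phi$, and there exist $\lambda^*\in\partial P(\mathcal U({\bf x}^*_{\bf y}))$ and $M^*\in N_{\mathcal K}(G({\bf x}^*_{\bf y}))$ such that $$\nabla\hat f({\bf x}^*_{\bf y})+\nabla\mathcal U({\bf x}^*_{\bf y})\lambda^*+\nabla G({\bf x}^*_{\bf y})M^*=0.$$ -/

import Mathlib

open Filter Topology Set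
open scoped Pointwise Gradient InnerProductSpace

noncomputable section

namespace SDC

/-! ### Variational analysis -/

section Variational

variable {E F : Type*} [NormedAddCommGroup E] [InnerProductSpace ℝ E]
  [NormedAddCommGroup F] [InnerProductSpace ℝ F]

/-- Fréchet (regular) subdifferential of a real valued function: all `v` with
`f w ≥ f w₀ + ⟪v, w - w₀⟫ - o(‖w - w₀‖)` as `w → w₀`. -/
def frechetSubdiff (f : E → ℝ) (w₀ : E) : Set E :=
  {v | ∀ ε > 0, ∀ᶠ w in 𝓝 w₀, f w₀ + ⟪v, w - w₀⟫_ℝ - ε * ‖w - w₀‖ ≤ f w}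

/-- Limiting (Mordukhovich) subdifferential of a real valued function. -/
def limitingSubdiff (f : E → ℝ) (w₀ : E) : Set E :=
  {v | ∃ (w : ℕ → E) (g : ℕ → E),
    Tendsto w atTop (𝓝 w₀) ∧ Tendsto (fun k => f (w k)) atTop (𝓝 (f w₀)) ∧
    (∀ k, g k ∈ frechetSubdiff f (w k)) ∧ Tendsto g atTop (𝓝 v)}

/-- Horizon subdifferential of a real valued function. -/
def horizonSubdiff (f : E → ℝ) (w₀ : E) : Set E :=
  {v | ∃ (w : ℕ → E) (g : ℕ → E) (α : ℕ → ℝ),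
    Tendsto w atTop (𝓝 w₀) ∧ Tendsto (fun k => f (w k)) atTop (𝓝 (f w₀)) ∧
    (∀ k, g k ∈ frechetSubdiff f (w k)) ∧
    (∀ k, 0 < α k) ∧ Antitone α ∧ Tendsto α atTop (𝓝 0) ∧
    Tendsto (fun k => α k • g k) atTop (𝓝 v)}

/-- Fréchet (regular) normal cone; empty outside `Ω`. -/
def frechetNormalCone (Ω : Set E) (w₀ : E) : Set E :=
  {v | w₀ ∈ Ω ∧ ∀ ε > 0, ∀ᶠ w in 𝓝[Ω] w₀, ⟪v, w - w₀⟫_ℝ ≤ ε * ‖w - w₀‖}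

/-- Limiting (Mordukhovich) normal cone; empty outside `Ω`. -/
def normalCone (Ω : Set E) (w₀ : E) : Set E :=
  {v | w₀ ∈ Ω ∧ ∃ (w : ℕ → E) (g : ℕ → E),
    Tendsto w atTop (𝓝 w₀) ∧ (∀ k, g k ∈ frechetNormalCone Ω (w k)) ∧ Tendsto g atTop (𝓝 v)}

/-- The polar cone `{v | ⟪v, w⟫ ≤ 0 for all w ∈ C}`. -/
def polarCone (C : Set E) : Set E := {v | ∀ w ∈ C, ⟪v, w⟫_ℝ ≤ 0}

/-- The metric projection onto a set (meaningful for nonempty closed convex sets). -/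
def proj (Ω : Set E) (z : E) : E :=
  Classical.epsilon fun p => p ∈ Ω ∧ ∀ q ∈ Ω, ‖z - p‖ ≤ ‖z - q‖

theorem proj_spec [CompleteSpace E] {Ω : Set E} (hne : Ω.Nonempty) (hcl : IsClosed Ω)
    (hcv : Convex ℝ Ω) (z : E) : proj Ω z ∈ Ω ∧ ∀ q ∈ Ω, ‖z - proj Ω z‖ ≤ ‖z - q‖ := by
  obtain ⟨p, hp, h⟩ := exists_norm_eq_iInf_of_complete_convex hne hcl.isComplete hcv z
  refine Classical.epsilon_spec
    (p := fun p => p ∈ Ω ∧ ∀ q ∈ Ω, ‖z - p‖ ≤ ‖z - q‖) ⟨p, hp, fun q hq => ?_⟩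
  rw [h]
  exact ciInf_le (f := fun w : Ω => ‖z - w‖)
    ⟨0, Set.forall_mem_range.2 fun _ => norm_nonneg _⟩ ⟨q, hq⟩

/-- `∇ L(w)`: the transpose (adjoint) of the Jacobian of `L` at `w`. -/
def jacT [CompleteSpace E] [CompleteSpace F] (L : E → F) (w : E) : F →L[ℝ] E :=
  ContinuousLinearMap.adjoint (fderiv ℝ L w)

/-- The proximal mapping of `ρ f`: all minimizers of `w' ↦ ‖w' - w‖² / (2ρ) + f w'`. -/
def prox (ρ : ℝ) (f : E → ℝ) (w : E) : Set E :=
  {ζ | ∀ w', 1 / (2 * ρ) * ‖ζ - w‖ ^ 2 + f ζ ≤ 1 / (2 * ρ) * ‖w' - w‖ ^ 2 + f w'}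

/-- The convex function `D_{ρ,f}` of the difference-of-convex decomposition
`‖w‖² / (2ρ) - D_{ρ,f}(w)` of the Moreau envelope of `f`
(the supremum is finite when `f` is bounded below and `ρ > 0`). -/
def dcPart (ρ : ℝ) (f : E → ℝ) (w : E) : ℝ :=
  ⨆ w', (1 / ρ * ⟪w, w'⟫_ℝ - 1 / (2 * ρ) * ‖w'‖ ^ 2 - f w')

end Variational

/-! ### The two-stage program -/

/-- Column vectors with the Euclidean norm. -/
abbrev Vec (n : ℕ) : Type := EuclideanSpace ℝ (Fin n)

/-- The data of a two-stage nonconvex nonsmooth stochastic conic program. Scenario `i` has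
probability `p i`; quantities that depend on the scenario take `i` as their first argument. -/
structure TwoStageProgram where
  (K m₁ m₂ n₁ n₂ s₁ s₂ k₁ : ℕ)
  k₂ : Fin K → ℕ
  p : Fin K → ℝ
  p_pos : ∀ i, 0 < p i
  p_sum : ∑ i, p i = 1
  c : Vec m₁ → ℝ
  q : Fin K → Vec m₂ → ℝ
  P₁ : Vec k₁ → ℝ
  U₁ : Matrix (Fin k₁) (Fin m₁) ℝ
  u₁ : Vec k₁
  P₂ : (i : Fin K) → Vec (k₂ i) → ℝ
  U₂ : (i : Fin K) → Matrix (Fin (k₂ i)) (Fin m₂) ℝ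
  u₂ : (i : Fin K) → Vec (k₂ i)
  A : Matrix (Fin n₁) (Fin m₁) ℝ
  a : Vec n₁
  B : Matrix (Fin s₁) (Fin m₁) ℝ
  b : Vec s₁
  A₁ : Fin K → Matrix (Fin n₂) (Fin m₂) ℝ
  A₂ : Fin K → Matrix (Fin n₂) (Fin m₁) ℝ
  d : Fin K → Vec n₂
  W : Fin K → Matrix (Fin s₂) (Fin m₂) ℝ
  T : Fin K → Matrix (Fin s₂) (Fin m₁) ℝ
  h : Fin K → Vec s₂
  C₁ : ProperCone ℝ (Vec s₁)
  C₂ : Fin K → ProperCone ℝ (Vec s₂)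

namespace TwoStageProgram

variable (S : TwoStageProgram)

/-- Primal variables `(x; y₁, …, y_K)`. -/
abbrev Primal : Type :=
  WithLp 2 (Vec S.m₁ × PiLp 2 (fun _ : Fin S.K => Vec S.m₂))

/-- Constraint values and multipliers `(α₁; α₂; π₁,ᵢ; π₂,ᵢ)`. -/
abbrev Dual : Type :=
  WithLp 2 (Vec S.n₁ × WithLp 2 (Vec S.s₁ ×
    WithLp 2 (PiLp 2 (fun _ : Fin S.K => Vec S.n₂) × PiLp 2 (fun _ : Fin S.K => Vec S.s₂))))

/-- Primal-dual variables `z = (x_y; M)`. -/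
abbrev PD : Type := WithLp 2 (S.Primal × S.Dual)

/-- The space of `(U₁ x + u₁; U_{ξᵢ} yᵢ + u_{ξᵢ})`. -/
abbrev Inner : Type :=
  WithLp 2 (Vec S.k₁ × PiLp 2 (fun i : Fin S.K => Vec (S.k₂ i)))

/-- Smooth part of the objective. -/
def fhat (w : S.Primal) : ℝ := S.c w.fst + ∑ i, S.p i * S.q i (w.snd i)

/-- Inner affine map of the nonsmooth part. -/
def U (w : S.Primal) : S.Inner :=
  WithLp.toLp 2 (Matrix.toEuclideanLin S.U₁ w.fst + S.u₁,
    WithLp.toLp 2 fun i => Matrix.toEuclideanLin (S.U₂ i) (w.snd i) + S.u₂ i)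

/-- Outer function of the nonsmooth part: the nonsmooth part of the objective is `P ∘ U`. -/
def P (v : S.Inner) : ℝ := S.P₁ v.fst + ∑ i, S.p i * S.P₂ i (v.snd i)

def G1 (w : S.Primal) : Vec S.n₁ := Matrix.toEuclideanLin S.A w.fst - S.a

def G2 (w : S.Primal) : Vec S.s₁ := Matrix.toEuclideanLin S.B w.fst - S.b

def G1ξ (w : S.Primal) (i : Fin S.K) : Vec S.n₂ :=
  Matrix.toEuclideanLin (S.A₁ i) (w.snd i) + Matrix.toEuclideanLin (S.A₂ i) w.fst - S.d i

def G2ξ (w : S.Primal) (i : Fin S.K) : Vec S.s₂ :=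
  Matrix.toEuclideanLin (S.W i) (w.snd i) + Matrix.toEuclideanLin (S.T i) w.fst - S.h i

/-- Constraint map. -/
def G (w : S.Primal) : S.Dual :=
  WithLp.toLp 2 (S.G1 w, WithLp.toLp 2 (S.G2 w,
    WithLp.toLp 2 (WithLp.toLp 2 (S.G1ξ w), WithLp.toLp 2 (S.G2ξ w))))

/-- The cone `{0} × (-C₁) × {0}^K × ∏ᵢ (-C_{2,ξᵢ})`. -/
def cone : Set S.Dual :=
  {v | v.fst = 0 ∧ v.snd.fst ∈ -(S.C₁ : Set (Vec S.s₁)) ∧ (∀ i, v.snd.snd.fst i = 0) ∧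
    ∀ i, v.snd.snd.snd i ∈ -(S.C₂ i : Set (Vec S.s₂))}

/-- Feasible set. -/
def feasible : Set S.Primal := {w | S.G w ∈ S.cone}

/-- `D = ℝ^{m₁} × (ℝ^{m₂})^K × 𝒦°`. -/
def D : Set S.PD := {z | z.snd ∈ polarCone S.cone}

/-! ### Assumptions -/

/-- The nonsmooth functions are lower semicontinuous and bounded from below. -/
def A1 : Prop :=
  (LowerSemicontinuous S.P₁ ∧ BddBelow (range S.P₁)) ∧
    ∀ i, LowerSemicontinuous (S.P₂ i) ∧ BddBelow (range (S.P₂ i))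

/-- The smooth functions are convex and twice continuously differentiable. -/
def A2 : Prop :=
  (ContDiff ℝ 2 S.c ∧ ConvexOn ℝ univ S.c) ∧ ∀ i, ContDiff ℝ 2 (S.q i) ∧ ConvexOn ℝ univ (S.q i)

/-- Slater condition. -/
def A5 : Prop :=
  ∃ w : S.Primal, S.G1 w = 0 ∧ (∀ i, S.G1ξ w i = 0) ∧
    S.G2 w ∈ interior (-(S.C₁ : Set (Vec S.s₁))) ∧
    ∀ i, S.G2ξ w i ∈ interior (-(S.C₂ i : Set (Vec S.s₂)))

/-- `∇U(x*) λ = 0` and `λ ∈ ∂^∞ P(U(x*))` imply `λ = 0`. -/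
def A7 (xs : S.Primal) : Prop :=
  ∀ lam ∈ horizonSubdiff S.P (S.U xs), jacT S.U xs lam = 0 → lam = 0

/-- The nonsmooth functions are continuous. -/
def A10 : Prop := Continuous S.P₁ ∧ ∀ i, Continuous (S.P₂ i)

/-- `-∇U(x*) ∂^∞ P(U(x*)) ∩ N_Φ(x*)` contains no nonzero vector. -/
def A11 (xs : S.Primal) : Prop :=
  -(jacT S.U xs '' horizonSubdiff S.P (S.U xs)) ∩ normalCone S.feasible xs ⊆ {0}

/-! ### KKT points -/

/-- KKT point of `min f̂ + P ∘ U` subject to `G ∈ 𝒦`. -/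
def IsKKT (xs : S.Primal) : Prop :=
  xs ∈ S.feasible ∧ ∃ lam ∈ limitingSubdiff S.P (S.U xs), ∃ M ∈ normalCone S.cone (S.G xs),
    ∇ S.fhat xs + jacT S.U xs lam + jacT S.G xs M = 0

/-! ### The linearized subproblem -/

/-- Objective `F^L` of the linearized Moreau envelope approximation at the point `w₀`, where
`ζ` collects the chosen elements of the proximal mappings at `w₀`, so that
`⟪Uᵀζ / ρ, · - w₀⟫` is the linear term. -/
def FL (ρ τ₁ τ₂ : ℝ) (w₀ : S.Primal) (ζ : S.Inner) (w : S.Primal) : ℝ :=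
  S.fhat w +
  (1 / (2 * ρ) * ‖Matrix.toEuclideanLin S.U₁ w.fst + S.u₁‖ ^ 2
    - dcPart ρ S.P₁ (Matrix.toEuclideanLin S.U₁ w₀.fst + S.u₁)
    - ⟪(1 / ρ) • Matrix.toEuclideanLin S.U₁.transpose ζ.fst, w.fst - w₀.fst⟫_ℝ
    + τ₁ / 2 * ‖w.fst - w₀.fst‖ ^ 2) +
  ∑ i, S.p i *
    (1 / (2 * ρ) * ‖Matrix.toEuclideanLin (S.U₂ i) (w.snd i) + S.u₂ i‖ ^ 2
      - dcPart ρ (S.P₂ i) (Matrix.toEuclideanLin (S.U₂ i) (w₀.snd i) + S.u₂ i)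
      - ⟪(1 / ρ) • Matrix.toEuclideanLin (S.U₂ i).transpose (ζ.snd i), w.snd i - w₀.snd i⟫_ℝ
      + τ₂ / 2 * ‖w.snd i - w₀.snd i‖ ^ 2)

/-- `((U₁ x + u₁ - ζ₁) / ρ; pᵢ (U_{ξᵢ} yᵢ + u_{ξᵢ} - ζ_{ξᵢ}) / ρ)`. -/
def lamL (ρ : ℝ) (ζ : S.Inner) (w : S.Primal) : S.Inner :=
  WithLp.toLp 2 ((1 / ρ) • ((S.U w).fst - ζ.fst),
    WithLp.toLp 2 fun i => S.p i • ((1 / ρ) • ((S.U w).snd i - ζ.snd i)))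

/-- Gradient of the quadratic regularization,
`(τ₁ (x - x₀); pᵢ τ₂ (yᵢ - y₀ᵢ))`. -/
def regL (τ₁ τ₂ : ℝ) (w₀ w : S.Primal) : S.Primal :=
  WithLp.toLp 2 (τ₁ • (w.fst - w₀.fst),
    WithLp.toLp 2 fun i => (S.p i * τ₂) • (w.snd i - w₀.snd i))

/-- The map of the two-stage variational inequality of the linearized subproblem; its first
block is `∇F^L(x_y) + ∇G(x_y) M`. -/
def HL (ρ τ₁ τ₂ : ℝ) (w₀ : S.Primal) (ζ : S.Inner) (z : S.PD) : S.PD :=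
  WithLp.toLp 2
    (∇ S.fhat z.fst + jacT S.G z.fst z.snd + jacT S.U z.fst (S.lamL ρ ζ z.fst)
      + S.regL τ₁ τ₂ w₀ z.fst,
     -S.G z.fst)

/-- Natural residual map of the two-stage variational inequality. -/
def HLnat (ρ τ₁ τ₂ : ℝ) (w₀ : S.Primal) (ζ : S.Inner) (z : S.PD) : S.PD :=
  z - proj S.D (z - S.HL ρ τ₁ τ₂ w₀ ζ z)

/-! ### The SDC method -/

/-- A run of the successive difference-of-convex method. `zout t` is the outer iterate, `z t l`
(`l ≤ L t`) are the inner iterates of outer iteration `t`, and `L t` is the number of inner steps.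
The inner variational inequality is solved inexactly by any procedure, so `z t (l + 1)` is any
point that passes the two accuracy tests. -/
structure SDCRun where
  (η₁ η₂ η₃ τ₁ τ₂ : ℝ)
  η_pos : 0 < η₁ ∧ 0 < η₂ ∧ 0 < η₃
  τ_pos : 0 < τ₁ ∧ 0 < τ₂
  ρ : ℕ → ℝ
  ρ_pos : ∀ t, 0 < ρ t
  ρ_tendsto : Tendsto ρ atTop (𝓝 0)
  zout : ℕ → S.PD
  z : ℕ → ℕ → S.PD
  L : ℕ → ℕ
  ζ : ℕ → ℕ → S.Inner
  /-- Initialization in `D`. -/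
  init_mem : zout 0 ∈ S.D
  /-- The inner loop is started at the initial point or, as a warm start, at the last outer
  iterate. -/
  start : ∀ t, z t 0 = zout 0 ∨ z t 0 = zout t
  L_pos : ∀ t, 1 ≤ L t
  /-- Choice of elements of the proximal mappings. -/
  prox₁ : ∀ t, ∀ l < L t, (ζ t l).fst ∈ prox (ρ t) S.P₁ (S.U (z t l).fst).fst
  prox₂ : ∀ t, ∀ l < L t, ∀ i, (ζ t l).snd i ∈ prox (ρ t) (S.P₂ i) ((S.U (z t l).fst).snd i)
  /-- Residual test for the inexact solution of the variational inequality. -/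
  residual : ∀ t, ∀ l < L t,
    ‖S.HLnat (ρ t) τ₁ τ₂ (z t l).fst (ζ t l) (z t (l + 1))‖ ≤ η₁ * ρ t
  /-- Approximate decrease test. -/
  decrease : ∀ t, ∀ l < L t,
    S.FL (ρ t) τ₁ τ₂ (z t l).fst (ζ t l) (z t (l + 1)).fst ≤
      S.FL (ρ t) τ₁ τ₂ (z t l).fst (ζ t l) (z t l).fst + η₂ / ((l : ℝ) + 1) ^ 2
  /-- The inner loop stops as soon as the step is small. -/
  stop_iff : ∀ t, ∀ l < L t,
    (τ₁ * ‖(z t (l + 1)).fst.fst - (z t l).fst.fst‖ +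
      τ₂ * ∑ i, S.p i * ‖(z t (l + 1)).fst.snd i - (z t l).fst.snd i‖ ≤ η₃ * ρ t ^ 2) ↔
      l + 1 = L t
  /-- Outer update. -/
  update : ∀ t, zout (t + 1) = z t (L t)

end TwoStageProgram

end SDC

end

noncomputable section

namespace SDC

/-! ### Multiplier bounds from the Slater condition and limits of KKT systems. -/

section Multipliers

open ContinuousLinearMap (adjoint adjoint_inner_left adjoint_inner_right)

variable {E F Y : Type*} [NormedAddCommGroup E] [InnerProductSpace ℝ E]
  [NormedAddCommGroup F] [InnerProductSpace ℝ F] [NormedAddCommGroup Y] [InnerProductSpace ℝ Y]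

/-! Everything is extracted from the last inner step of each outer iteration, leading from `w₀` to
`z` with parameter `ρ`. Optimality in the prox makes the weighted quotient (U(w₀) - ζ)/ρ a Fréchet
subgradient of `P` at ζ, and since the stopping test gives ‖z - w₀‖ = O(ρ²), replacing `w₀` by `z`
in it costs only O(ρ). A natural residual of size O(ρ) means that multiplier and constraint value
become an exactly complementary pair after an O(ρ) perturbation (`residual_spec`). Hence, with Q and
J the linear parts of `U` and `G`, g_k + Q†λ_k + J†M_k = 0, where g_k → ∇f̂(x*) and λ_k is a
subgradient at ζ_k → U(x*).

The limit is taken in `exists_kkt_of_tendsto`. If no subsequence of λ_k is bounded, dividing by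
‖λ_k‖ produces a unit horizon subgradient l with -Q†l normal to the feasible set, which `A11` and
`A7` forbid. The M_k may be unbounded, for instance when equality constraints are redundant, but
only J†M_k and complementarity matter. Once the component invisible to both is removed, the Slater
point bounds the rest (`exists_multiplier_bound`, `exists_multiplier_of_tendsto`). -/

theorem smul_mem_polarCone {C : Set F} {M : F} (hM : M ∈ polarCone C) {t : ℝ} (ht : 0 ≤ t) :
    t • M ∈ polarCone C := fun w hw => by
  rw [real_inner_smul_left]
  exact mul_nonpos_of_nonneg_of_nonpos ht (hM w hw)

theorem isClosed_polarCone (C : Set F) : IsClosed (polarCone C) := by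
  have : polarCone C = ⋂ w ∈ C, {v : F | ⟪v, w⟫_ℝ ≤ 0} := by ext; simp [polarCone]
  rw [this]
  exact isClosed_biInter fun w _ => isClosed_le (by fun_prop) continuous_const

theorem convex_polarCone (C : Set F) : Convex ℝ (polarCone C) := by
  intro a ha b hb s t hs ht _ w hw
  rw [inner_add_left, real_inner_smul_left, real_inner_smul_left]
  exact add_nonpos (mul_nonpos_of_nonneg_of_nonpos hs (ha w hw))
    (mul_nonpos_of_nonneg_of_nonpos ht (hb w hw))

theorem mem_normalCone_of_inner_le {Ω : Set E} {x v : E} (hx : x ∈ Ω)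
    (h : ∀ w ∈ Ω, ⟪v, w - x⟫_ℝ ≤ 0) : v ∈ normalCone Ω x := by
  refine ⟨hx, fun _ => x, fun _ => v, tendsto_const_nhds, fun _ => ⟨hx, fun ε hε => ?_⟩,
    tendsto_const_nhds⟩
  filter_upwards [self_mem_nhdsWithin] with w hw
  exact (h w hw).trans (by positivity)

theorem mem_normalCone_of_mem_polarCone {K : Set F} {M x : F} (hx : x ∈ K)
    (hM : M ∈ polarCone K) (hc : ⟪M, x⟫_ℝ = 0) : M ∈ normalCone K x :=
  mem_normalCone_of_inner_le hx fun w hw => by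
    rw [inner_sub_right, hc, sub_zero]; exact hM w hw

variable [FiniteDimensional ℝ E] [FiniteDimensional ℝ F] [FiniteDimensional ℝ Y]

/-- If `g` is interior to `K` relative to the subspace `V`, multipliers `M` in the span of `V` and
the range of `J` are bounded in terms of `J†M` and `⟪M, g⟫`. -/
theorem exists_multiplier_bound (J : E →L[ℝ] F) {K : Set F} {V : Submodule ℝ F} {g : F} {ε : ℝ}
    (hε : 0 < ε) (hg : ∀ e ∈ V, ‖e‖ ≤ ε → g + e ∈ K) :
    ∃ δ > 0, ∀ M ∈ polarCone K, M ∈ (V.subtypeL.coprod J).range →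
      δ * ‖M‖ ≤ ‖adjoint J M‖ - ⟪M, g⟫_ℝ := by
  set T := V.subtypeL.coprod J
  -- Open mapping onto the finite-dimensional range: each M there splits as e + J d with e in `V`
  -- and (e, d) of norm at most C‖M‖.
  obtain ⟨C, hC, hpre⟩ := T.rangeRestrict.exists_preimage_norm_le
    (fun ⟨y, x, hx⟩ => ⟨x, Subtype.ext hx⟩)
  have hm : 0 < min ε 1 := lt_min hε one_pos
  refine ⟨min ε 1 / C, by positivity, fun M hM hMT => ?_⟩
  rcases eq_or_ne M 0 with rfl | hM0
  · simp
  have hMn : 0 < ‖M‖ := norm_pos_iff.2 hM0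
  obtain ⟨⟨e, d⟩, hed, hn⟩ := hpre ⟨M, hMT⟩
  have hed' : (e : F) + J d = M := congrArg Subtype.val hed
  have hn' : ‖(e, d)‖ ≤ C * ‖M‖ := hn
  -- This scale makes t e admissible in the ball around `g` and t d of norm at most 1.
  set t := min ε 1 / (C * ‖M‖) with ht
  have ht0 : 0 < t := by positivity
  have htn : t * (C * ‖M‖) = min ε 1 := by rw [ht]; field_simp
  have he : ‖t • (e : F)‖ ≤ ε := by
    rw [norm_smul, Real.norm_of_nonneg ht0.le]
    calc t * ‖(e : F)‖ ≤ t * (C * ‖M‖) := by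
          gcongr; exact (norm_fst_le (e, d)).trans hn'
      _ ≤ ε := by rw [htn]; exact min_le_left _ _
  have hd : ‖t • d‖ ≤ 1 := by
    rw [norm_smul, Real.norm_of_nonneg ht0.le]
    calc t * ‖d‖ ≤ t * (C * ‖M‖) := by
          gcongr; exact (norm_snd_le (e, d)).trans hn'
      _ ≤ 1 := by rw [htn]; exact min_le_right _ _
  have h1 := hM _ (hg _ (V.smul_mem t e.2) he)
  rw [inner_add_right] at h1
  have h2 : ⟪M, J (t • d)⟫_ℝ ≤ ‖adjoint J M‖ := by
    rw [← adjoint_inner_left]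
    calc _ ≤ ‖adjoint J M‖ * ‖t • d‖ := real_inner_le_norm _ _
      _ ≤ ‖adjoint J M‖ * 1 := by gcongr
      _ = _ := mul_one _
  -- The left side is t‖M‖², because e + J d = M.
  have h3 : ⟪M, t • (e : F)⟫_ℝ + ⟪M, J (t • d)⟫_ℝ = min ε 1 / C * ‖M‖ := by
    rw [map_smul, ← inner_add_right, ← smul_add, hed', real_inner_smul_right,
      real_inner_self_eq_norm_sq, ht]
    field_simp
  linarith

/-- Under the Slater condition the images `J†M` of multipliers are closed under limits along
perturbed complementary pairs. -/
theorem exists_multiplier_of_tendsto (J : E →L[ℝ] F) {G : E → F}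
    (hG : ∀ w w', G w - G w' = J (w - w')) {K : Set F} {V : Submodule ℝ F} (hKV : K ⊆ V)
    {w₀ : E} {ε : ℝ} (hε : 0 < ε) (hg : ∀ e ∈ V, ‖e‖ ≤ ε → G w₀ + e ∈ K)
    {w : ℕ → E} {xs : E} (hw : Tendsto w atTop (𝓝 xs)) {r M : ℕ → F}
    (hr : Tendsto r atTop (𝓝 0)) (hM : ∀ k, M k ∈ polarCone K) (hK : ∀ k, G (w k) + r k ∈ K)
    (hc : ∀ k, ⟪M k, G (w k) + r k⟫_ℝ = 0) {v : E}
    (hv : Tendsto (fun k => adjoint J (M k)) atTop (𝓝 v)) :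
    ∃ N ∈ polarCone K, ⟪N, G xs⟫_ℝ = 0 ∧ adjoint J N = v := by
  set S := (V.subtypeL.coprod J).range
  have hVS : ∀ e ∈ V, e ∈ S := fun e he => ⟨(⟨e, he⟩, 0), by simp⟩
  have hJS : ∀ d, J d ∈ S := fun d => ⟨(0, d), by simp⟩
  obtain ⟨δ, hδ, hbd⟩ := exists_multiplier_bound J hε hg
  -- Projecting onto V + range J preserves pairings with `K` and with the range of `J`, hence
  -- polarity, complementarity and J†M; only the uncontrolled orthogonal part is lost.
  set M' : ℕ → F := fun k => S.starProjection (M k) with hM'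
  have hin : ∀ k, ∀ s ∈ S, ⟪M' k, s⟫_ℝ = ⟪M k, s⟫_ℝ := fun k s hs => by
    rw [hM', S.inner_starProjection_left_eq_right, S.starProjection_eq_self_iff.2 hs]
  have hMp : ∀ k, M' k ∈ polarCone K := fun k s hs => by
    rw [hin k s (hVS s (hKV hs))]; exact hM k s hs
  have hMS : ∀ k, M' k ∈ S := fun k => S.starProjection_apply_mem _
  have hadj : ∀ k, adjoint J (M' k) = adjoint J (M k) := fun k =>
    ext_inner_right ℝ fun d => by
      rw [adjoint_inner_left, adjoint_inner_left, hin k _ (hJS d)]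
  have hc' : ∀ k, ⟪M' k, G (w k) + r k⟫_ℝ = 0 := fun k => by
    rw [hin k _ (hVS _ (hKV (hK k))), hc k]
  have hGc : Tendsto (fun k => G (w k) + r k) atTop (𝓝 (G xs)) := by
    have h : ∀ k, G (w k) + r k = G xs + J (w k - xs) + r k := fun k => by rw [← hG]; abel
    simp_rw [h]
    have h1 : Tendsto (fun k => J (w k - xs)) atTop (𝓝 0) := by
      have := (J.continuous.tendsto _).comp (hw.sub_const xs)
      rwa [sub_self, map_zero] at this
    simpa using (h1.const_add (G xs)).add hr
  -- Moving from the Slater point `w₀` to `w k` changes `G` by `J (w k - w₀)`, and complementarity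
  -- removes the value at `w k` up to `r k`.
  have hest : ∀ k, δ * ‖M' k‖ ≤
      ‖adjoint J (M k)‖ * (1 + ‖w k - w₀‖) + ‖M' k‖ * ‖r k‖ := fun k => by
    have h1 := hbd _ (hMp k) (hMS k)
    rw [hadj] at h1
    have h2 : ⟪M' k, G w₀⟫_ℝ =
        - ⟪M' k, r k⟫_ℝ - ⟪adjoint J (M k), w k - w₀⟫_ℝ := by
      rw [← hadj, adjoint_inner_left, ← hG, inner_sub_right]
      have := hc' k
      rw [inner_add_right] at this
      linarith
    have h3 := real_inner_le_norm (M' k) (r k)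
    have h4 := real_inner_le_norm (adjoint J (M k)) (w k - w₀)
    linarith
  have hB : ∀ᶠ k in atTop, ‖adjoint J (M k)‖ * (1 + ‖w k - w₀‖) <
      ‖v‖ * (1 + ‖xs - w₀‖) + 1 :=
    (hv.norm.mul ((hw.sub_const w₀).norm.const_add 1)).eventually_lt_const (lt_add_one _)
  have hrs : ∀ᶠ k in atTop, ‖r k‖ < δ / 2 := by
    have := hr.norm
    rw [norm_zero] at this
    exact this.eventually_lt_const (by positivity)
  -- Half of `δ` absorbs the term ‖M'‖‖r‖.
  set R := (‖v‖ * (1 + ‖xs - w₀‖) + 1) / (δ / 2) with hR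
  have hbdd : ∀ᶠ k in atTop, M' k ∈ Metric.closedBall (0 : F) R := by
    filter_upwards [hB, hrs] with k h1 h2
    rw [mem_closedBall_zero_iff, hR, le_div_iff₀ (by positivity)]
    have := hest k
    nlinarith [norm_nonneg (M' k)]
  obtain ⟨N, -, φ, hφ, hN⟩ :=
    tendsto_subseq_of_frequently_bounded Metric.isBounded_closedBall hbdd.frequently
  refine ⟨N, (isClosed_polarCone K).mem_of_tendsto hN (Eventually.of_forall fun k => hMp _), ?_, ?_⟩
  · refine tendsto_nhds_unique ?_ (tendsto_const_nhds (f := atTop (α := ℕ)))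
    refine (hN.inner (hGc.comp hφ.tendsto_atTop)).congr fun k => ?_
    exact hc' _
  · refine tendsto_nhds_unique (((adjoint J).continuous.tendsto N).comp hN) ?_
    refine (hv.comp hφ.tendsto_atTop).congr fun k => ?_
    exact (hadj _).symm

/-- Puts J†N into the normal cone of the feasible set, the form in which `A11` can be applied. -/
theorem adjoint_mem_normalCone_preimage (J : E →L[ℝ] F) {G : E → F}
    (hG : ∀ w w', G w - G w' = J (w - w')) {K : Set F} {x : E} (hx : G x ∈ K) {M : F}
    (hM : M ∈ polarCone K) (hc : ⟪M, G x⟫_ℝ = 0) :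
    adjoint J M ∈ normalCone {w | G w ∈ K} x :=
  mem_normalCone_of_inner_le hx fun w hw => by
    rw [adjoint_inner_left, ← hG, inner_sub_right, hc, sub_zero]; exact hM _ hw

/-- Limits of approximate KKT systems are KKT systems, under the Slater condition and the two
qualification conditions on the horizon subdifferential. -/
theorem exists_kkt_of_tendsto (J : E →L[ℝ] F) {G : E → F}
    (hG : ∀ w w', G w - G w' = J (w - w')) {K : Set F} {V : Submodule ℝ F} (hKV : K ⊆ V)
    {w₀ : E} {ε : ℝ} (hε : 0 < ε) (hg : ∀ e ∈ V, ‖e‖ ≤ ε → G w₀ + e ∈ K)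
    (Q : E →L[ℝ] Y) {f : Y → ℝ} {u : Y} {xs : E} (hxs : G xs ∈ K)
    (h7 : ∀ lam ∈ horizonSubdiff f u, adjoint Q lam = 0 → lam = 0)
    (h11 : -(adjoint Q '' horizonSubdiff f u) ∩ normalCone {w | G w ∈ K} xs ⊆ {0})
    {w : ℕ → E} (hw : Tendsto w atTop (𝓝 xs)) {r M : ℕ → F}
    (hr : Tendsto r atTop (𝓝 0)) (hM : ∀ k, M k ∈ polarCone K) (hK : ∀ k, G (w k) + r k ∈ K)
    (hc : ∀ k, ⟪M k, G (w k) + r k⟫_ℝ = 0) {ζ lam : ℕ → Y} (hζ : Tendsto ζ atTop (𝓝 u))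
    (hf : Tendsto (fun k => f (ζ k)) atTop (𝓝 (f u)))
    (hlam : ∀ k, lam k ∈ frechetSubdiff f (ζ k)) {g : ℕ → E} {g₀ : E}
    (hgr : Tendsto g atTop (𝓝 g₀))
    (heq : ∀ k, g k + adjoint Q (lam k) + adjoint J (M k) = 0) :
    ∃ l ∈ limitingSubdiff f u, ∃ N ∈ normalCone K (G xs),
      g₀ + adjoint Q l + adjoint J N = 0 := by
  have heq' : ∀ k, adjoint J (M k) = -(g k + adjoint Q (lam k)) := fun k =>
    (neg_eq_of_add_eq_zero_right (heq k)).symm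
  by_cases hbd : ∃ C : ℝ, ∃ᶠ k in atTop, lam k ∈ Metric.closedBall (0 : Y) C
  · obtain ⟨C, hC⟩ := hbd
    obtain ⟨l, -, φ, hφ, hl⟩ :=
      tendsto_subseq_of_frequently_bounded Metric.isBounded_closedBall hC
    have hφt := hφ.tendsto_atTop
    obtain ⟨N, hN, hNc, hNv⟩ := exists_multiplier_of_tendsto J hG hKV hε hg (hw.comp hφt)
      (hr.comp hφt) (fun k => hM (φ k)) (fun k => hK (φ k)) (fun k => hc (φ k))
      (v := -(g₀ + adjoint Q l)) (by
        simp_rw [heq']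
        exact ((hgr.comp hφt).add (((adjoint Q).continuous.tendsto l).comp hl)).neg)
    refine ⟨l, ⟨ζ ∘ φ, lam ∘ φ, hζ.comp hφt, hf.comp hφt, fun k => hlam _, hl⟩, N,
      mem_normalCone_of_mem_polarCone hxs hN hNc, ?_⟩
    rw [hNv, add_neg_cancel]
  · exfalso
    have hinf : Tendsto (fun k => ‖lam k‖) atTop atTop := by
      refine tendsto_atTop.2 fun C => ?_
      push Not at hbd
      filter_upwards [hbd C] with k hk
      rw [mem_closedBall_zero_iff, not_le] at hk
      exact hk.le
    -- Increasing norms make the reciprocals antitone, as the horizon subdifferential requires.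
    obtain ⟨φ, hφ, hφm⟩ := strictMono_subseq_of_tendsto_atTop hinf
    -- The shift by one skips the first term, the only one that could vanish.
    have hpos : ∀ k, 0 < ‖lam (φ (k + 1))‖ := fun k =>
      (norm_nonneg (lam (φ k))).trans_lt (hφm (Nat.lt_succ_self k))
    obtain ⟨l, hl, χ, hχ, hlim⟩ := tendsto_subseq_of_bounded
      (Metric.isBounded_sphere (x := (0 : Y)) (r := 1))
      (x := fun k => ‖lam (φ (k + 1))‖⁻¹ • lam (φ (k + 1))) fun k => by
        rw [mem_sphere_zero_iff_norm, norm_smul, norm_inv, norm_norm,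
          inv_mul_cancel₀ (hpos k).ne']
    rw [Metric.isClosed_sphere.closure_eq, mem_sphere_zero_iff_norm] at hl
    set θ : ℕ → ℕ := fun k => φ (χ k + 1) with hθ
    set α : ℕ → ℝ := fun k => ‖lam (θ k)‖⁻¹ with hα
    have hθm : StrictMono θ := fun i j hij => hφ (Nat.succ_lt_succ (hχ hij))
    have hθt := hθm.tendsto_atTop
    have hα0 : Tendsto α atTop (𝓝 0) := tendsto_inv_atTop_zero.comp (hinf.comp hθt)
    have hαpos : ∀ k, 0 < α k := fun k => inv_pos.2 (hpos _)
    have hlim' : Tendsto (fun k => α k • lam (θ k)) atTop (𝓝 l) := hlim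
    have hlh : l ∈ horizonSubdiff f u :=
      ⟨ζ ∘ θ, lam ∘ θ, α, hζ.comp hθt, hf.comp hθt, fun k => hlam _, hαpos,
        fun i j hij => inv_anti₀ (hpos _)
          (hφm.monotone (Nat.succ_le_succ (hχ.monotone hij))), hα0, hlim'⟩
    have hv : Tendsto (fun k => adjoint J (α k • M (θ k))) atTop (𝓝 (-adjoint Q l)) := by
      have h : ∀ k, adjoint J (α k • M (θ k)) =
          -(α k • g (θ k) + adjoint Q (α k • lam (θ k))) := fun k => by
        rw [map_smul, heq', map_smul, smul_neg, smul_add]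
      simp_rw [h]
      simpa using ((hα0.smul (hgr.comp hθt)).add
        (((adjoint Q).continuous.tendsto l).comp hlim')).neg
    obtain ⟨N, hN, hNc, hNv⟩ := exists_multiplier_of_tendsto J hG hKV hε hg (hw.comp hθt)
      (hr.comp hθt) (fun k => smul_mem_polarCone (hM (θ k)) (hαpos k).le) (fun k => hK (θ k))
      (fun k => by
        rw [real_inner_smul_left]
        exact mul_eq_zero_of_right _ (hc (θ k))) hv
    have hn := adjoint_mem_normalCone_preimage J hG hxs hN hNc
    rw [hNv] at hn
    -- After scaling, g drops out and -Q†l = J†N is normal; the two qualifications then force l = 0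
    -- against ‖l‖ = 1.
    have h0 : -adjoint Q l = 0 := h11 ⟨Set.neg_mem_neg.2 ⟨l, hlh, rfl⟩, hn⟩
    rw [h7 l hlh (neg_eq_zero.1 h0), norm_zero] at hl
    exact zero_ne_one hl

end Multipliers

/-! ### Projections and complementarity for cones. -/

section Projection

variable {E : Type*} [NormedAddCommGroup E] [InnerProductSpace ℝ E] [CompleteSpace E]

theorem proj_mem_and_inner_le {Ω : Set E} (hne : Ω.Nonempty) (hcl : IsClosed Ω)
    (hcv : Convex ℝ Ω) (z : E) :
    proj Ω z ∈ Ω ∧ ∀ q ∈ Ω, ⟪z - proj Ω z, q - proj Ω z⟫_ℝ ≤ 0 := by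
  obtain ⟨hp, hmin⟩ := proj_spec hne hcl hcv z
  refine ⟨hp, (norm_eq_iInf_iff_real_inner_le_zero hcv hp).1 (le_antisymm ?_ ?_)⟩
  · have : Nonempty Ω := ⟨⟨_, hp⟩⟩
    exact le_ciInf fun q => hmin q q.2
  · exact ciInf_le (f := fun w : Ω => ‖z - w‖)
      ⟨0, Set.forall_mem_range.2 fun _ => norm_nonneg _⟩ ⟨_, hp⟩

/-- Normal vectors to the polar of a closed convex cone are complementary elements of the cone. -/
theorem complementary_of_inner_le {C : ProperCone ℝ E} {M v : E}
    (hM : M ∈ polarCone (C : Set E)) (h : ∀ N ∈ polarCone (C : Set E), ⟪v, N - M⟫_ℝ ≤ 0) :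
    v ∈ C ∧ ⟪M, v⟫_ℝ = 0 := by
  -- Testing at 0 and at 2M bounds ⟪v, M⟫ from both sides, so it vanishes.
  have h0 := h 0 fun w _ => by simp
  have h2 := h ((2 : ℝ) • M) (smul_mem_polarCone hM zero_le_two)
  rw [two_smul, add_sub_cancel_right] at h2
  rw [zero_sub, inner_neg_right] at h0
  have hc : ⟪v, M⟫_ℝ = 0 := by linarith
  refine ⟨?_, by rw [real_inner_comm, hc]⟩
  -- Bidual theorem; the inner dual is the negative of the polar cone.
  rw [← C.innerDual_innerDual, ProperCone.mem_innerDual]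
  intro y hy
  have hy' : -y ∈ polarCone (C : Set E) := fun w hw => by
    rw [inner_neg_left, real_inner_comm]
    exact neg_nonpos.2 (ProperCone.mem_innerDual.1 hy hw)
  have := h _ hy'
  rw [inner_sub_right, hc, inner_neg_right, real_inner_comm] at this
  linarith

end Projection

section Affine

variable {E F : Type*} [NormedAddCommGroup E] [InnerProductSpace ℝ E] [CompleteSpace E]
  [NormedAddCommGroup F] [InnerProductSpace ℝ F] [CompleteSpace F]

theorem jacT_eq_adjoint {L : E → F} {J : E →L[ℝ] F} (h : ∀ w w', L w - L w' = J (w - w'))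
    (w : E) : jacT L w = ContinuousLinearMap.adjoint J := by
  have hL : L = fun v => J v + (L w - J w) := funext fun v => by
    rw [add_sub_left_comm, ← map_sub, ← h, add_sub_cancel]
  have : HasFDerivAt L J w := by
    rw [hL]
    exact J.hasFDerivAt.add_const _
  rw [jacT, this.fderiv]

end Affine

/-! ### Proximal points: convergence and subgradients. -/

section Prox

variable {E : Type*} [NormedAddCommGroup E]

/-- Comparing ζ with the competitor v itself gives ‖ζ - v‖² ≤ 2ρ(f(v) - m) for a lower bound m of f,
and f(v) converges by continuity. -/
theorem tendsto_of_mem_prox {f : E → ℝ} (hf : Continuous f) (hb : BddBelow (range f))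
    {ρ : ℕ → ℝ} (hρ : ∀ k, 0 < ρ k) (hρ0 : Tendsto ρ atTop (𝓝 0)) {v ζ : ℕ → E} {u : E}
    (hv : Tendsto v atTop (𝓝 u)) (hζ : ∀ k, ζ k ∈ prox (ρ k) f (v k)) :
    Tendsto ζ atTop (𝓝 u) := by
  obtain ⟨m, hm⟩ := hb
  have hle : ∀ k, ‖ζ k - v k‖ ^ 2 ≤ 2 * ρ k * (f (v k) - m) := fun k => by
    have h1 := hζ k (v k)
    have h2 := hm (mem_range_self (ζ k))
    rw [sub_self, norm_zero, one_div_mul_eq_div] at h1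
    have h3 : ‖ζ k - v k‖ ^ 2 / (2 * ρ k) ≤ f (v k) - m := by linarith
    rw [div_le_iff₀ (by have := hρ k; positivity)] at h3
    linarith
  have hz : Tendsto (fun k => 2 * ρ k * (f (v k) - m)) atTop (𝓝 0) := by
    simpa using (hρ0.const_mul 2).mul (((hf.tendsto u).comp hv).sub_const m)
  have hsq : Tendsto (fun k => ‖ζ k - v k‖ ^ 2) atTop (𝓝 0) :=
    squeeze_zero (fun _ => by positivity) hle hz
  have hn : Tendsto (fun k => ζ k - v k) atTop (𝓝 0) := by
    rw [tendsto_zero_iff_norm_tendsto_zero]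
    simpa using hsq.sqrt
  simpa using hn.add hv

variable [InnerProductSpace ℝ E]

/-- Expanding ‖w - v‖² around ζ turns minimality into a quadratic minorant touching f at ζ, that is,
a proximal subgradient. -/
theorem le_of_mem_prox {ρ : ℝ} {f : E → ℝ} {v ζ : E} (h : ζ ∈ prox ρ f v) (w : E) :
    f ζ + ⟪(1 / ρ) • (v - ζ), w - ζ⟫_ℝ - 1 / (2 * ρ) * ‖w - ζ‖ ^ 2 ≤ f w := by
  have h1 := h w
  have h2 : ‖w - v‖ ^ 2 = ‖w - ζ‖ ^ 2 - 2 * ⟪v - ζ, w - ζ⟫_ℝ + ‖ζ - v‖ ^ 2 := by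
    rw [← sub_sub_sub_cancel_right w v ζ, norm_sub_sq_real, real_inner_comm, norm_sub_rev v ζ]
  rw [h2] at h1
  rw [real_inner_smul_left]
  have h3 : 1 / (2 * ρ) * (2 * ⟪v - ζ, w - ζ⟫_ℝ) = 1 / ρ * ⟪v - ζ, w - ζ⟫_ℝ := by
    rw [one_div, one_div, mul_inv]; ring
  linarith

theorem mem_frechetSubdiff_of_le {f : E → ℝ} {x v : E} {C : ℝ}
    (h : ∀ w, f x + ⟪v, w - x⟫_ℝ - C * ‖w - x‖ ^ 2 ≤ f w) : v ∈ frechetSubdiff f x := by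
  intro ε hε
  have ht : Tendsto (fun w => C * ‖w - x‖) (𝓝 x) (𝓝 0) := by
    have : Continuous fun w => C * ‖w - x‖ := by fun_prop
    simpa using this.tendsto x
  filter_upwards [ht.eventually_lt_const hε] with w hw
  refine le_trans ?_ (h w)
  have : C * ‖w - x‖ ^ 2 ≤ ε * ‖w - x‖ := by
    rw [pow_two, ← mul_assoc]
    gcongr
  linarith

end Prox

section WithLpLimits

variable {α β ι : Type*} {γ : ι → Type*} [TopologicalSpace α] [TopologicalSpace β]
  [∀ i, TopologicalSpace (γ i)] {X : Type*} {l : Filter X}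

theorem tendsto_withLp_prod_pi {f : X → WithLp 2 (α × PiLp 2 γ)} {a : WithLp 2 (α × PiLp 2 γ)}
    (h₁ : Tendsto (fun x => (f x).fst) l (𝓝 a.fst))
    (h₂ : ∀ i, Tendsto (fun x => (f x).snd i) l (𝓝 (a.snd i))) : Tendsto f l (𝓝 a) := by
  have h3 : Tendsto (fun x => (f x).snd) l (𝓝 a.snd) :=
    ((PiLp.continuous_toLp 2 γ).tendsto a.snd.ofLp).comp (tendsto_pi_nhds.2 h₂)
  exact ((WithLp.prod_continuous_toLp 2 α (PiLp 2 γ)).tendsto a.ofLp).comp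
    (h₁.prodMk_nhds h3)

end WithLpLimits

section WithLpMaps

variable {E α β ι : Type*} {γ : ι → Type*} [NormedAddCommGroup E] [NormedSpace ℝ E]
  [NormedAddCommGroup α] [NormedSpace ℝ α] [NormedAddCommGroup β] [NormedSpace ℝ β] [Fintype ι]
  [∀ i, NormedAddCommGroup (γ i)] [∀ i, NormedSpace ℝ (γ i)]

/-- The pairing of two continuous linear maps, with values in the `L²` product. -/
def prodL2 (f : E →L[ℝ] α) (g : E →L[ℝ] β) : E →L[ℝ] WithLp 2 (α × β) :=
  (WithLp.prodContinuousLinearEquiv 2 ℝ α β).symm ∘L f.prod g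

/-- The continuous linear map into an `L²` product given by a family of maps. -/
def piL2 (f : ∀ i, E →L[ℝ] γ i) : E →L[ℝ] PiLp 2 γ :=
  (PiLp.continuousLinearEquiv 2 ℝ γ).symm ∘L ContinuousLinearMap.pi f

end WithLpMaps

/-! ### The cone, affine maps and variational inequality of the two-stage program. -/

namespace TwoStageProgram

variable (S : TwoStageProgram)

/-- The constraint cone as a closed convex cone. -/
def properCone : ProperCone ℝ S.Dual where
  carrier := S.cone
  add_mem' := by
    rintro v w ⟨h1, h2, h3, h4⟩ ⟨h1', h2', h3', h4'⟩
    refine ⟨by simp [h1, h1'], ?_, fun i => by simp [h3 i, h3' i], fun i => ?_⟩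
    · simpa [add_comm] using add_mem h2 h2'
    · simpa [add_comm] using add_mem (h4 i) (h4' i)
  zero_mem' := by
    refine ⟨rfl, ?_, fun i => rfl, fun i => ?_⟩ <;> simp
  smul_mem' := by
    rintro c v ⟨h1, h2, h3, h4⟩
    refine ⟨by simp [h1], ?_, fun i => by simp [h3 i], fun i => ?_⟩
    · simpa using S.C₁.smul_mem h2 c.2
    · simpa using (S.C₂ i).smul_mem (h4 i) c.2
  isClosed' := by
    have : S.cone = {v : S.Dual | v.fst = 0} ∩ {v : S.Dual | -v.snd.fst ∈ S.C₁} ∩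
        (⋂ i, {v : S.Dual | v.snd.snd.fst i = 0}) ∩
        ⋂ i, {v : S.Dual | -v.snd.snd.snd i ∈ S.C₂ i} := by
      ext v
      simp [cone, and_assoc]
    change IsClosed S.cone
    rw [this]
    refine ((IsClosed.inter ?_ ?_).inter (isClosed_iInter fun i => ?_)).inter
      (isClosed_iInter fun i => ?_)
    · exact isClosed_eq (by fun_prop) continuous_const
    · exact S.C₁.isClosed.preimage (f := fun v : S.Dual => -v.snd.fst) (by fun_prop)
    · exact isClosed_eq (by fun_prop) continuous_const
    · exact (S.C₂ i).isClosed.preimage (f := fun v : S.Dual => -v.snd.snd.snd i) (by fun_prop)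

/-- Linear part of `U`. -/
def linU : S.Primal →L[ℝ] S.Inner :=
  prodL2 ((Matrix.toEuclideanLin S.U₁).toContinuousLinearMap ∘L WithLp.fstL 2 ℝ _ _)
    (piL2 fun i => (Matrix.toEuclideanLin (S.U₂ i)).toContinuousLinearMap ∘L
      PiLp.proj 2 _ i ∘L WithLp.sndL 2 ℝ _ _)

/-- Linear part of `G`. -/
def linG : S.Primal →L[ℝ] S.Dual :=
  prodL2 ((Matrix.toEuclideanLin S.A).toContinuousLinearMap ∘L WithLp.fstL 2 ℝ _ _)
    (prodL2 ((Matrix.toEuclideanLin S.B).toContinuousLinearMap ∘L WithLp.fstL 2 ℝ _ _)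
      (prodL2
        (piL2 fun i => (Matrix.toEuclideanLin (S.A₁ i)).toContinuousLinearMap ∘L
            PiLp.proj 2 _ i ∘L WithLp.sndL 2 ℝ _ _ +
          (Matrix.toEuclideanLin (S.A₂ i)).toContinuousLinearMap ∘L WithLp.fstL 2 ℝ _ _)
        (piL2 fun i => (Matrix.toEuclideanLin (S.W i)).toContinuousLinearMap ∘L
            PiLp.proj 2 _ i ∘L WithLp.sndL 2 ℝ _ _ +
          (Matrix.toEuclideanLin (S.T i)).toContinuousLinearMap ∘L WithLp.fstL 2 ℝ _ _)))

theorem U_eq (w : S.Primal) :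
    S.U w = S.linU w + WithLp.toLp 2 (S.u₁, WithLp.toLp 2 S.u₂) := rfl

theorem G_eq (w : S.Primal) :
    S.G w = S.linG w - WithLp.toLp 2 (S.a, WithLp.toLp 2 (S.b, WithLp.toLp 2
      (WithLp.toLp 2 S.d, WithLp.toLp 2 S.h))) := rfl

theorem G_sub (w w' : S.Primal) : S.G w - S.G w' = S.linG (w - w') := by
  rw [G_eq, G_eq, map_sub]; abel

theorem U_sub (w w' : S.Primal) : S.U w - S.U w' = S.linU (w - w') := by
  rw [U_eq, U_eq, map_sub]; abel

theorem jacT_U (w : S.Primal) : jacT S.U w = ContinuousLinearMap.adjoint S.linU :=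
  jacT_eq_adjoint S.U_sub w

theorem jacT_G (w : S.Primal) : jacT S.G w = ContinuousLinearMap.adjoint S.linG :=
  jacT_eq_adjoint S.G_sub w

theorem continuous_G : Continuous S.G := by
  rw [funext S.G_eq]
  exact S.linG.continuous.sub continuous_const

theorem continuous_U : Continuous S.U := by
  rw [funext S.U_eq]
  exact S.linU.continuous.add continuous_const

theorem continuous_P (h : S.A10) : Continuous S.P := by
  unfold P
  refine Continuous.add (h.1.comp (WithLp.continuous_fst ..)) (continuous_finsetSum _ fun i _ => ?_)
  exact continuous_const.mul ((h.2 i).comp (by fun_prop))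

theorem continuous_gradient_fhat (h : S.A2) : Continuous (∇ S.fhat) := by
  have hc : ContDiff ℝ 2 S.fhat := by
    unfold fhat
    refine ContDiff.add (h.1.1.comp (g := S.c)
      (WithLp.fstL 2 ℝ (Vec S.m₁) (PiLp 2 fun _ : Fin S.K => Vec S.m₂)).contDiff)
      (ContDiff.sum fun i _ => ?_)
    refine contDiff_const.mul ((h.2 i).1.comp ?_)
    exact (PiLp.proj 2 (fun _ : Fin S.K => Vec S.m₂) i ∘L 
      WithLp.sndL 2 ℝ (Vec S.m₁) (PiLp 2 fun _ : Fin S.K => Vec S.m₂)).contDiff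
  exact (LinearIsometryEquiv.continuous _).comp (hc.continuous_fderiv two_ne_zero)

/-- The values of the inequality constraints. -/
def ineqSpace : Submodule ℝ S.Dual where
  carrier := {v | v.fst = 0 ∧ ∀ i, v.snd.snd.fst i = 0}
  add_mem' := by
    rintro v w ⟨h1, h2⟩ ⟨h1', h2'⟩
    exact ⟨by simp [h1, h1'], fun i => by simp [h2 i, h2' i]⟩
  zero_mem' := ⟨rfl, fun _ => rfl⟩
  smul_mem' := by
    rintro c v ⟨h1, h2⟩
    exact ⟨by simp [h1], fun i => by simp [h2 i]⟩

/-- Perturbations in `ineqSpace` leave the equality blocks at zero, while the finitely many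
inequality blocks stay in their cones by interiority. -/
theorem exists_slater_ball (h : S.A5) : ∃ w : S.Primal, ∃ ε > 0, ∀ e ∈ S.ineqSpace, ‖e‖ ≤ ε →
    S.G w + e ∈ S.cone := by
  obtain ⟨w, h1, h2, h3, h4⟩ := h
  have e1 : ∀ᶠ e : S.Dual in 𝓝 0, S.G2 w + e.snd.fst ∈ -(S.C₁ : Set (Vec S.s₁)) := by
    have hc : Continuous fun e : S.Dual => S.G2 w + e.snd.fst := by fun_prop
    have := hc.tendsto 0
    simp only [WithLp.zero_snd, WithLp.zero_fst, add_zero] at this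
    exact this (mem_interior_iff_mem_nhds.1 h3)
  have e2 : ∀ᶠ e : S.Dual in 𝓝 0, ∀ i,
      S.G2ξ w i + e.snd.snd.snd i ∈ -(S.C₂ i : Set (Vec S.s₂)) := by
    refine eventually_all.2 fun i => ?_
    have hc : Continuous fun e : S.Dual => S.G2ξ w i + e.snd.snd.snd i := by fun_prop
    have := hc.tendsto 0
    simp only [WithLp.zero_snd, PiLp.zero_apply, add_zero] at this
    exact this (mem_interior_iff_mem_nhds.1 (h4 i))
  obtain ⟨ε, hε, hb⟩ := Metric.nhds_basis_closedBall.eventually_iff.1 (e1.and e2)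
  refine ⟨w, ε, hε, fun e he hn => ?_⟩
  obtain ⟨hb1, hb2⟩ := hb (mem_closedBall_zero_iff.2 hn)
  refine ⟨?_, hb1, fun i => ?_, hb2⟩
  · change S.G1 w + e.fst = 0
    rw [h1, he.1, add_zero]
  · change S.G1ξ w i + e.snd.snd.fst i = 0
    rw [h2 i, he.2 i, add_zero]

/-- Multiplication of the scenario blocks by the probabilities. -/
def weight : S.Inner →L[ℝ] S.Inner :=
  prodL2 (WithLp.fstL 2 ℝ _ _) (piL2 fun i => S.p i • PiLp.proj 2 _ i ∘L WithLp.sndL 2 ℝ _ _)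

theorem lamL_eq (ρ : ℝ) (ζ : S.Inner) (w : S.Primal) :
    S.lamL ρ ζ w = S.weight ((1 / ρ) • (S.U w - ζ)) := rfl

/-- The block minorants add up. Since p_i ≤ 1, the weighted quadratic errors are dominated by the
common constant 1/(2ρ), so the sum is again a quadratic minorant. -/
theorem lamL_mem_frechetSubdiff {ρ : ℝ} (hρ : 0 < ρ) {w : S.Primal} {ζ : S.Inner}
    (h₁ : ζ.fst ∈ prox ρ S.P₁ (S.U w).fst)
    (h₂ : ∀ i, ζ.snd i ∈ prox ρ (S.P₂ i) ((S.U w).snd i)) :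
    S.lamL ρ ζ w ∈ frechetSubdiff S.P ζ := by
  refine mem_frechetSubdiff_of_le (C := 1 / (2 * ρ)) fun v => ?_
  have e1 := le_of_mem_prox h₁ v.fst
  have e2 : ∀ i, S.p i * S.P₂ i (ζ.snd i) +
      ⟪S.p i • ((1 / ρ) • ((S.U w).snd i - ζ.snd i)), v.snd i - ζ.snd i⟫_ℝ
      - 1 / (2 * ρ) * ‖v.snd i - ζ.snd i‖ ^ 2 ≤ S.p i * S.P₂ i (v.snd i) := fun i => by
    have hp := S.p_pos i
    have hp1 : S.p i ≤ 1 := by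
      rw [← S.p_sum]
      exact Finset.single_le_sum (fun j _ => (S.p_pos j).le) (Finset.mem_univ i)
    have := mul_le_mul_of_nonneg_left (le_of_mem_prox (h₂ i) (v.snd i)) hp.le
    rw [real_inner_smul_left (r := S.p i)]
    have h3 : S.p i * (1 / (2 * ρ) * ‖v.snd i - ζ.snd i‖ ^ 2) ≤
        1 / (2 * ρ) * ‖v.snd i - ζ.snd i‖ ^ 2 :=
      mul_le_of_le_one_left (by positivity) hp1
    linarith
  have e3 := Finset.sum_le_sum fun i (_ : i ∈ Finset.univ) => e2 i
  rw [Finset.sum_sub_distrib, Finset.sum_add_distrib, ← Finset.mul_sum] at e3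
  have hn : ‖v - ζ‖ ^ 2 = ‖v.fst - ζ.fst‖ ^ 2 + ∑ i, ‖v.snd i - ζ.snd i‖ ^ 2 := by
    rw [WithLp.prod_norm_sq_eq_of_L2, PiLp.norm_sq_eq_of_L2 _ (v - ζ).snd]
    rfl
  have hi : ⟪S.lamL ρ ζ w, v - ζ⟫_ℝ = ⟪(1 / ρ) • ((S.U w).fst - ζ.fst), v.fst - ζ.fst⟫_ℝ +
      ∑ i, ⟪S.p i • ((1 / ρ) • ((S.U w).snd i - ζ.snd i)), v.snd i - ζ.snd i⟫_ℝ := by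
    rw [WithLp.prod_inner_apply, PiLp.inner_apply]
    rfl
  rw [hn, hi]
  unfold P
  linarith

/-- The natural residual `r` of the variational inequality measures the violation of stationarity,
and perturbs the multiplier and the constraint value to a complementary pair. -/
theorem residual_spec {ρ τ₁ τ₂ : ℝ} {w₀ : S.Primal} {ζ : S.Inner} {z r : S.PD}
    (hr : S.HLnat ρ τ₁ τ₂ w₀ ζ z = r) :
    r.fst = ∇ S.fhat z.fst + jacT S.G z.fst z.snd + jacT S.U z.fst (S.lamL ρ ζ z.fst)
      + S.regL τ₁ τ₂ w₀ z.fst ∧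
    z.snd - r.snd ∈ polarCone S.cone ∧ S.G z.fst + r.snd ∈ S.cone ∧
    ⟪z.snd - r.snd, S.G z.fst + r.snd⟫_ℝ = 0 := by
  have hcl : IsClosed S.D := (isClosed_polarCone S.cone).preimage (WithLp.continuous_snd ..)
  have hcv : Convex ℝ S.D :=
    (convex_polarCone S.cone).linear_preimage (WithLp.sndL 2 ℝ _ _).toLinearMap
  have hne : S.D.Nonempty := ⟨0, fun w _ => by simp⟩
  obtain ⟨hp, hi⟩ := proj_mem_and_inner_le hne hcl hcv (z - S.HL ρ τ₁ τ₂ w₀ ζ z)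
  set H := S.HL ρ τ₁ τ₂ w₀ ζ z with hH
  set p := proj S.D (z - H) with hpd
  have hr' : z - p = r := hr
  have hpz : p = z - r := by rw [← hr']; abel
  have hv : z - H - p = r - H := by rw [← hr']; abel
  rw [hv] at hi
  rw [hpz] at hp hi
  -- `D` leaves the primal block free, so moving by this very difference shows its squared norm is
  -- at most 0.
  have hfst : r.fst - H.fst = 0 := by
    have := hi (WithLp.toLp 2 ((z - r).fst + (r.fst - H.fst), (z - r).snd)) hp
    rw [WithLp.prod_inner_apply] at this
    simpa using this
  have hM : z.snd - r.snd ∈ polarCone (S.properCone : Set S.Dual) := hp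
  have hcomp := complementary_of_inner_le (v := S.G z.fst + r.snd) hM fun N hN => by
    have := hi (WithLp.toLp 2 ((z - r).fst, N)) hN
    rw [WithLp.prod_inner_apply] at this
    have hs : (r - H).snd = S.G z.fst + r.snd := by
      rw [WithLp.sub_snd, hH]
      simp [HL, add_comm]
    simpa [← hs] using this
  exact ⟨sub_eq_zero.1 hfst, hp, hcomp.1, hcomp.2⟩

end TwoStageProgram
-- Passage to the limit along the iterates.
namespace TwoStageProgram

variable (S : TwoStageProgram)

theorem regL_eq (τ₁ τ₂ : ℝ) (w₀ w : S.Primal) : S.regL τ₁ τ₂ w₀ w = S.regL τ₁ τ₂ 0 (w - w₀) := by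
  unfold regL
  simp

theorem tendsto_regL (τ₁ τ₂ : ℝ) {d : ℕ → S.Primal} (hd : Tendsto d atTop (𝓝 0)) :
    Tendsto (fun k => S.regL τ₁ τ₂ 0 (d k)) atTop (𝓝 0) := by
  refine tendsto_withLp_prod_pi ?_ fun i => ?_
  · have hc : Continuous fun d : S.Primal => τ₁ • (d.fst - (0 : S.Primal).fst) := by fun_prop
    have := (hc.tendsto 0).comp hd
    rw [sub_self, smul_zero] at this
    exact this
  · have hc : Continuous fun d : S.Primal =>
        (S.p i * τ₂) • (d.snd i - (0 : S.Primal).snd i) := by fun_prop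
    have := (hc.tendsto 0).comp hd
    rw [sub_self, smul_zero] at this
    exact this

/-- The stopping test of the inner loop forces the steps to be of smaller order than `ρ`. -/
theorem tendsto_inv_smul_step {τ₁ τ₂ η : ℝ} (hτ : 0 < τ₁ ∧ 0 < τ₂) {ρ : ℕ → ℝ}
    (hρ : ∀ k, 0 < ρ k) (hρ0 : Tendsto ρ atTop (𝓝 0)) {d : ℕ → S.Primal}
    (hd : ∀ k, τ₁ * ‖(d k).fst‖ + τ₂ * ∑ i, S.p i * ‖(d k).snd i‖ ≤ η * ρ k ^ 2) :
    Tendsto (fun k => (1 / ρ k) • d k) atTop (𝓝 0) := by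
  -- Applied blockwise: a‖v‖ ≤ ηρ² gives ‖v/ρ‖ ≤ (η/a)ρ.
  have key : ∀ {V : Type} [NormedAddCommGroup V] [NormedSpace ℝ V] {a : ℝ} (_ : 0 < a)
      {v : ℕ → V} (_ : ∀ k, a * ‖v k‖ ≤ η * ρ k ^ 2),
      Tendsto (fun k => (1 / ρ k) • v k) atTop (𝓝 0) := by
    intro V _ _ a ha v hv
    have hz : Tendsto (fun k => η / a * ρ k) atTop (𝓝 0) := by
      simpa using hρ0.const_mul (η / a)
    refine squeeze_zero_norm (fun k => ?_) hz
    have hk := hρ k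
    rw [norm_smul, Real.norm_of_nonneg (by positivity), one_div_mul_eq_div, div_le_iff₀ hk]
    have : ‖v k‖ ≤ η * ρ k ^ 2 / a := by
      rw [le_div_iff₀ ha, mul_comm]; exact hv k
    refine this.trans_eq ?_
    ring
  have hs : ∀ k, 0 ≤ ∑ i, S.p i * ‖(d k).snd i‖ := fun k =>
    Finset.sum_nonneg fun i _ => mul_nonneg (S.p_pos i).le (norm_nonneg _)
  refine tendsto_withLp_prod_pi ?_ fun i => ?_
  · refine key hτ.1 (v := fun k => (d k).fst) fun k => ?_
    have := hd k
    have := mul_nonneg hτ.2.le (hs k)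
    linarith
  · refine key (mul_pos hτ.2 (S.p_pos i)) (v := fun k => (d k).snd i) fun k => ?_
    have h1 := hd k
    have h2 := mul_nonneg hτ.1.le (norm_nonneg (d k).fst)
    have h3 : S.p i * ‖(d k).snd i‖ ≤ ∑ i, S.p i * ‖(d k).snd i‖ :=
      Finset.single_le_sum (f := fun i => S.p i * ‖(d k).snd i‖)
        (fun j _ => mul_nonneg (S.p_pos j).le (norm_nonneg _)) (Finset.mem_univ i)
    have h4 := mul_le_mul_of_nonneg_left h3 hτ.2.le
    linarith

/-- Limits of inexact solutions of linearized subproblems with vanishing smoothing parameter and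
small steps are KKT points. -/
theorem isKKT_of_tendsto {xs : S.Primal} (h1 : S.A1) (h2 : S.A2) (h5 : S.A5) (h7 : S.A7 xs)
    (h10 : S.A10) (h11 : S.A11 xs) {τ₁ τ₂ η₁ η₃ : ℝ} (hτ : 0 < τ₁ ∧ 0 < τ₂) {ρ : ℕ → ℝ}
    (hρ : ∀ k, 0 < ρ k) (hρ0 : Tendsto ρ atTop (𝓝 0)) {w₀ : ℕ → S.Primal} {z : ℕ → S.PD}
    {ζ : ℕ → S.Inner} (hz : Tendsto (fun k => (z k).fst) atTop (𝓝 xs))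
    (hp₁ : ∀ k, (ζ k).fst ∈ prox (ρ k) S.P₁ (S.U (w₀ k)).fst)
    (hp₂ : ∀ k i, (ζ k).snd i ∈ prox (ρ k) (S.P₂ i) ((S.U (w₀ k)).snd i))
    (hres : ∀ k, ‖S.HLnat (ρ k) τ₁ τ₂ (w₀ k) (ζ k) (z k)‖ ≤ η₁ * ρ k)
    (hstep : ∀ k, τ₁ * ‖(z k).fst.fst - (w₀ k).fst‖ +
      τ₂ * ∑ i, S.p i * ‖(z k).fst.snd i - (w₀ k).snd i‖ ≤ η₃ * ρ k ^ 2) :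
    S.IsKKT xs := by
  obtain ⟨ws, ε, hε, hball⟩ := S.exists_slater_ball h5
  set d : ℕ → S.Primal := fun k => (z k).fst - w₀ k with hd
  have hd1 : Tendsto (fun k => (1 / ρ k) • d k) atTop (𝓝 0) :=
    S.tendsto_inv_smul_step hτ hρ hρ0 hstep
  have hd0 : Tendsto d atTop (𝓝 0) := by
    have := hρ0.smul hd1
    rw [smul_zero] at this
    refine this.congr fun k => ?_
    rw [smul_smul, mul_one_div_cancel (hρ k).ne', one_smul]
  have hw₀ : Tendsto w₀ atTop (𝓝 xs) := by
    have := hz.sub hd0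
    rw [sub_zero] at this
    exact this.congr fun k => sub_sub_cancel _ _
  have hU := (S.continuous_U.tendsto xs).comp hw₀
  have hζ : Tendsto ζ atTop (𝓝 (S.U xs)) := by
    refine tendsto_withLp_prod_pi ?_ fun i => ?_
    · exact tendsto_of_mem_prox h10.1 h1.1.2 hρ hρ0
        (((WithLp.continuous_fst ..).tendsto (S.U xs)).comp hU) hp₁
    · have hc : Continuous fun v : S.Inner => v.snd i := by fun_prop
      exact tendsto_of_mem_prox (h10.2 i) (h1.2 i).2 hρ hρ0
        ((hc.tendsto (S.U xs)).comp hU) fun k => hp₂ k i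
  set r : ℕ → S.PD := fun k => S.HLnat (ρ k) τ₁ τ₂ (w₀ k) (ζ k) (z k) with hr
  have hr0 : Tendsto r atTop (𝓝 0) :=
    squeeze_zero_norm hres (by simpa using hρ0.const_mul η₁)
  have hr1 : Tendsto (fun k => (r k).fst) atTop (𝓝 0) :=
    ((WithLp.continuous_fst ..).tendsto (0 : S.PD)).comp hr0
  have hr2 : Tendsto (fun k => (r k).snd) atTop (𝓝 0) :=
    ((WithLp.continuous_snd ..).tendsto (0 : S.PD)).comp hr0
  have hspec := fun k => S.residual_spec (rfl : S.HLnat (ρ k) τ₁ τ₂ (w₀ k) (ζ k) (z k) = r k)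
  have hfeas : S.G xs ∈ S.cone := by
    have hG := ((S.continuous_G.tendsto xs).comp hz).add hr2
    rw [add_zero] at hG
    exact S.properCone.isClosed.mem_of_tendsto hG (Eventually.of_forall fun k => (hspec k).2.2.1)
  -- The subgradient is based at `w₀`, where the prox was evaluated, whereas the residual contains
  -- `lamL` at `z`.
  have hlam : ∀ k, S.lamL (ρ k) (ζ k) (w₀ k) ∈ frechetSubdiff S.P (ζ k) := fun k =>
    S.lamL_mem_frechetSubdiff (hρ k) (hp₁ k) (hp₂ k)
  have hlam_sub : ∀ k, S.lamL (ρ k) (ζ k) (z k).fst =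
      S.lamL (ρ k) (ζ k) (w₀ k) + S.weight (S.linU ((1 / ρ k) • d k)) := fun k => by
    have hs : S.linU ((1 / ρ k) • d k) = (1 / ρ k) • (S.U (z k).fst - S.U (w₀ k)) := by
      rw [map_smul, S.U_sub]
    rw [lamL_eq, lamL_eq, hs, ← map_add, ← smul_add, add_comm, sub_add_sub_cancel]
  -- Collects all that remains once the subgradient at `w₀` and the multiplier `z.snd - r.snd` are
  -- split off; the `linG` term compensates the shift of the multiplier.
  set g : ℕ → S.Primal := fun k => ∇ S.fhat (z k).fst + S.regL τ₁ τ₂ 0 (d k) - (r k).fst +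
    ContinuousLinearMap.adjoint S.linG (r k).snd +
    ContinuousLinearMap.adjoint S.linU (S.weight (S.linU ((1 / ρ k) • d k))) with hg
  have hgt : Tendsto g atTop (𝓝 (∇ S.fhat xs)) := by
    have e1 := ((S.continuous_gradient_fhat h2).tendsto xs).comp hz
    have e2 := S.tendsto_regL τ₁ τ₂ hd0
    have e3 := ((ContinuousLinearMap.adjoint S.linG).continuous.tendsto 0).comp hr2
    have e4 := (((ContinuousLinearMap.adjoint S.linU).continuous.comp
      (S.weight.continuous.comp S.linU.continuous)).tendsto 0).comp hd1
    have := (((e1.add e2).sub hr1).add e3).add e4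
    simp only [Function.comp_apply, map_zero, add_zero, sub_zero] at this
    exact this
  refine ⟨hfeas, ?_⟩
  rw [A7, jacT_U] at h7
  rw [A11, jacT_U] at h11
  rw [jacT_U, jacT_G]
  refine exists_kkt_of_tendsto S.linG S.G_sub (V := S.ineqSpace) (fun v hv => ⟨hv.1, hv.2.2.1⟩) hε
    hball S.linU hfeas h7 h11 hz hr2 (fun k => (hspec k).2.1) (fun k => (hspec k).2.2.1)
    (fun k => (hspec k).2.2.2) hζ (((S.continuous_P h10).tendsto _).comp hζ) hlam hgt fun k => ?_
  have h := (hspec k).1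
  rw [jacT_U, jacT_G, hlam_sub, regL_eq, map_add] at h
  rw [hg, map_sub]
  simp only
  rw [h]
  simp only [hd]
  abel

end TwoStageProgram

end SDC

end

theorem mainTheorem1 (S : SDC.TwoStageProgram) (R : S.SDCRun) (xs : S.Primal)
    (hxs : MapClusterPt xs atTop (fun t => (R.z t (R.L t)).fst))
    (h1 : S.A1) (h2 : S.A2) (h5 : S.A5) (h7 : S.A7 xs) (h10 : S.A10) (h11 : S.A11 xs) :
    S.IsKKT xs := by
  obtain ⟨φ, hφ, hx⟩ := hxs.tendsto_subseq
  -- The index L t - 1 of the last inner step is genuine because L t ≥ 1, and it is the step at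
  -- which the stopping test holds.
  have hL : ∀ t, R.L t - 1 + 1 = R.L t := fun t => Nat.sub_add_cancel (R.L_pos t)
  have hlt : ∀ t, R.L t - 1 < R.L t := fun t => Nat.sub_lt (R.L_pos t) one_pos
  have hres := fun t => R.residual t _ (hlt t)
  have hstep := fun t => (R.stop_iff t _ (hlt t)).2 (hL t)
  simp only [hL] at hres hstep
  exact S.isKKT_of_tendsto h1 h2 h5 h7 h10 h11 R.τ_pos (fun k => R.ρ_pos (φ k))
    (R.ρ_tendsto.comp hφ.tendsto_atTop) (w₀ := fun k => (R.z (φ k) (R.L (φ k) - 1)).fst)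
    (z := fun k => R.z (φ k) (R.L (φ k))) (ζ := fun k => R.ζ (φ k) (R.L (φ k) - 1)) hx
    (fun k => R.prox₁ _ _ (hlt _)) (fun k i => R.prox₂ _ _ (hlt _) i)
    (fun k => hres (φ k)) (fun k => hstep (φ k))
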